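/- Let $\mathcal A$ be an abelian category (with small Hom-sets) which is complete (has all small limits) and has an injective cogenerator. Let $\mathbf K(\mathcal A)$ be the homotopy category of cochain complexes over $\mathcal A$, and let $\mathbf D(\mathcal A)$ be its derived category, the localization of $\mathbf K(\mathcal A)$ at the quasi-isomorphisms (whose Hom-sets are not assumed to be small). For a complex $X$ and $n\in\mathbb N$ let $X^{\ge -n}=(\cdots\to 0\to B^{-n}(X)\to X^{-n}\to X^{-n+1}\to\cdots)$, where $B^{-n}(X)=\operatorname{im}(X^{-n-1}\to X^{-n})$ sits in degree $-n-1$. Assume that $\mathbf D(\mathcal A)$ is left-complete, i.e. that it has small products and that for every complex $X$ there is in $\mathbf D(\mathcal A)$ a distinguished triangle $X\to\prod_{n\in\mathbb N}X^{\ge -n}\xrightarrow{1-\mathrm{shift}}\prod_{n\in\mathbb N}X^{\ge -n}\to X[1]$, where the shift is induced by the canonical maps $X^{\ge -(n+1)}\to X^{\ge -n}$ (in other words, $X\cong\operatorname{holim}X^{\ge -n}$). Call a complex $E$ homotopically injective if $\mathbf K(\mathcal A)(N,E)=0$ for every acyclic complex $N$, and let $\mathbf K_{\rm inj}(\mathcal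 A)\subseteq\mathbf K(\mathcal A)$ be the full subcategory of these complexes. Then: 1. Every object $X$ of $\mathbf K(\mathcal A)$ has a homotopically injective resolution, i.e. a quasi-isomorphism $X\to E$ in $\mathbf K(\mathcal A)$ with $E$ homotopically injective. 2. The composite $\mathbf K_{\rm inj}(\mathcal A)\hookrightarrow\mathbf K(\mathcal A)\to\mathbf D(\mathcal A)$ is an equivalence of categories, and $\mathbf D(\mathcal A)$ has small Hom-sets. 3. Every left exact functor $F:\mathcal A\to\mathcal B$ to another abelian category $\mathcal B$ has a total right derived functor: writing $q_{\mathcal A}:\mathbf K(\mathcal A)\to\mathbf D(\mathcal A)$ and $q_{\mathcal B}:\mathbf K(\mathcal B)\to\mathbf D(\mathcal B)$ for the localization functors, there are a triangulated functor $\mathbf RF:\mathbf D(\mathcal A)\to\mathbf D(\mathcal B)$ and a natural transformation $\alpha:q_{\mathcal B}\circ F\to\mathbf RF\circ q_{\mathcal A}$, compatible with the shifts, such that for every functor $G:\mathbf D(\mathcal A)\to\mathbf D(\mathcal B)$ and every natural transformation $\beta:q_{\mathcal B}\circ F\to G\circ q_{\mathcal A}$ there is exactly one natural transformation $\gamma:\mathbf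 RF\to G$ with $\beta=(\gamma q_{\mathcal A})\circ\alpha$. 4. $\mathbf D(\mathcal A)^{\rm op}$ satisfies Brown representability: every functor from $\mathbf D(\mathcal A)$ to the category of (small) abelian groups which is homological (sends distinguished triangles to exact sequences) and preserves small products is naturally isomorphic to $\mathbf D(\mathcal A)(X,-)$ for some object $X$. -/

import Mathlib

open CategoryTheory Limits Pretriangulated

universe v v' w w' u u'

noncomputable section

namespace CochainComplex

variable {A : Type u} [Category.{v} A] [Abelian A]

/-- The truncation `X^{≥ m} = (⋯ → 0 → B^m(X) → X^m → X^{m+1} → ⋯)`, with `B^m(X)`, the image of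
`X^{m-1} → X^m`, in degree `m - 1`. It is the quotient of `X` by the subcomplex
`(⋯ → X^{m-2} → Z^{m-1}(X) → 0 → ⋯)`, which is `X.truncLE (m - 1)`. -/
def quotTruncGE (X : CochainComplex A ℤ) (m : ℤ) : CochainComplex A ℤ :=
  cokernel (X.ιTruncLE (m - 1))

/-- The canonical epimorphism from `X` to its truncation. -/
def quotTruncGEπ (X : CochainComplex A ℤ) (m : ℤ) : X ⟶ X.quotTruncGE m :=
  cokernel.π (X.ιTruncLE (m - 1))

lemma ιTruncLE_comp_quotTruncGEπ (X : CochainComplex A ℤ) {m m' : ℤ} (h : m' ≤ m) :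
    X.ιTruncLE (m' - 1) ≫ X.quotTruncGEπ m = 0 := by
  have := (X.truncLE (m' - 1)).isStrictlyLE_of_le (m' - 1) (m - 1) (by lia)
  have hnat := ιTruncLE_naturality (X.ιTruncLE (m' - 1)) (m - 1)
  have h0 : X.ιTruncLE (m - 1) ≫ X.quotTruncGEπ m = 0 := cokernel.condition _
  rw [← cancel_epi ((X.truncLE (m' - 1)).ιTruncLE (m - 1)), ← Category.assoc, ← hnat,
    Category.assoc, h0, comp_zero, comp_zero]

/-- The canonical map `X^{≥ m'} ⟶ X^{≥ m}` for `m' ≤ m`, compatible with the epimorphisms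
from `X`. -/
def quotTruncGEMap (X : CochainComplex A ℤ) {m m' : ℤ} (h : m' ≤ m) :
    X.quotTruncGE m' ⟶ X.quotTruncGE m :=
  cokernel.desc _ (X.quotTruncGEπ m) (X.ιTruncLE_comp_quotTruncGEπ h)

end CochainComplex

namespace CategoryTheory

section Triangulated

variable (T : Type u) [Category.{w} T] [HasZeroObject T] [HasShift T ℤ] [Preadditive T]
  [∀ n : ℤ, (shiftFunctor T n).Additive] [Pretriangulated T]

variable {T} in
/-- `Y` is a homotopy limit of the inverse tower `X 0 ⟵ X 1 ⟵ X 2 ⟵ ⋯` with transition maps `φ`: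
there is a distinguished triangle `Y ⟶ ∏ X n ⟶ ∏ X n ⟶ Y⟦1⟧` whose second map is `1 - shift`. -/
def IsHomotopyLimit (X : ℕ → T) [HasProduct X] (φ : ∀ n, X (n + 1) ⟶ X n) (Y : T) : Prop :=
  ∃ (p : Y ⟶ ∏ᶜ X) (δ : ∏ᶜ X ⟶ Y⟦(1 : ℤ)⟧),
    Triangle.mk p (𝟙 (∏ᶜ X) - Pi.lift fun n => Pi.π X (n + 1) ≫ φ n) δ ∈ distTriang T

/-- For a triangulated category `T` with small products, `Tᵒᵖ` satisfies Brown representability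
if every homological functor `F` from `T` to abelian groups that preserves small products is
representable, that is, isomorphic to `Hom(X, -)` for some `X`. The groups `Hom(X, Y)` are not
required to live in the universe `v` of the values of `F`. -/
def OppositeSatisfiesBrownRepresentability : Prop :=
  ∀ F : T ⥤ AddCommGrpCat.{v}, F.IsHomological →
    (∀ J : Type v, PreservesLimitsOfShape (Discrete J) F) →
    ∃ (X : T) (e : ∀ Y : T, (X ⟶ Y) ≃+ F.obj Y),
      ∀ (Y Z : T) (g : Y ⟶ Z) (f : X ⟶ Y), e Z (f ≫ g) = F.map g (e Y f)

end Triangulated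

section Derived

variable (A : Type u) [Category.{v} A] [Abelian A]

/-- The homotopically injective complexes in the homotopy category: those objects `X`
such that every morphism `N ⟶ X` with `N` acyclic is zero. -/
abbrev homotopicallyInjective : ObjectProperty (HomotopyCategory A (ComplexShape.up ℤ)) :=
  (HomotopyCategory.subcategoryAcyclic A).rightOrthogonal

variable [HasDerivedCategory.{w} A]

/-- The derived category of `A` is left-complete if it has small products and every complex `X`
is, in the derived category, isomorphic to a homotopy limit of the tower
`X^{≥ 0} ⟵ X^{≥ -1} ⟵ X^{≥ -2} ⟵ ⋯` of its truncations. -/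
def IsLeftCompleteDerivedCategory : Prop :=
  ∃ _ : HasProducts.{v} (DerivedCategory A),
    haveI : HasProducts.{0} (DerivedCategory A) := has_smallest_products_of_hasProducts.{v}
    ∀ X : CochainComplex A ℤ,
      IsHomotopyLimit (fun n : ℕ => DerivedCategory.Q.obj (X.quotTruncGE (-(n : ℤ))))
        (fun n => DerivedCategory.Q.map
          (X.quotTruncGEMap (m := -(n : ℤ)) (m' := -((n + 1 : ℕ) : ℤ)) (by lia)))
        (DerivedCategory.Q.obj X)

variable {A}
variable {B : Type u'} [Category.{v'} B] [Abelian B] [HasDerivedCategory.{w'} B]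

/-- The additive functor `F : A ⥤ B` has a total right derived functor: a triangulated functor
`RF` between the derived categories with a natural transformation `α` of functors commuting with
shifts, from the functor `K(A) ⥤ K(B) ⥤ D(B)` induced by `F` to `K(A) ⥤ D(A) ⥤ D(B)` induced
by `RF`, such that `(RF, α)` is initial among all such pairs (even among the not necessarily
triangulated ones). -/
def HasTotalRightDerivedFunctor (F : A ⥤ B) [F.Additive] : Prop :=
  ∃ (RF : DerivedCategory A ⥤ DerivedCategory B) (_ : RF.CommShift ℤ)
    (α : F.mapHomotopyCategory (ComplexShape.up ℤ) ⋙ DerivedCategory.Qh ⟶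
      DerivedCategory.Qh ⋙ RF),
    RF.IsTriangulated ∧ NatTrans.CommShift α ℤ ∧
      RF.IsRightDerivedFunctor α (HomotopyCategory.quasiIso A (ComplexShape.up ℤ))

end Derived

end CategoryTheory

end

/-! Products in `A` need not be exact, so products in D(A) are computed only on K-injective
complexes: a product of these is K-injective, and `DerivedCategory.Q` preserves it
(`nonempty_isLimit_Q_of_isKInjective`). The cogenerator gives enough injectives, so each truncation
of X is isomorphic in D(A) to a bounded below complex of injectives, which is K-injective. The
objects of D(A) isomorphic to K-injectives form a triangulated subcategory closed under small
products; left-completeness places X in a triangle with two products of truncations, so this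
subcategory is everything. Morphisms into an object of D(A) can then be computed in K(A), the
localization has a right adjoint R, and F applied after R is the derived functor.

Brown representability is a solution-set argument. `Functor.IsSolvableOn` asks for one element
generating the values of F on a class of objects, and for relations on any element to be killed by
passing to another one. This holds for a small set of objects and passes to small products,
retracts, small unions and, in the main step `IsSolvableOn.extensionProduct`, to extensions. These
operations build D(A) from the shifts of the cogenerator: products and retracts give injective
stalks, iterated extensions the bounded complexes, a homotopy limit of brutal truncations the
bounded below ones, and left-completeness all the rest. Solvability on all objects yields a
corepresenting object by splitting an idempotent (`IsSolvableOn.exists_equiv`). -/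

noncomputable section

namespace CategoryTheory

namespace Functor

/-! ### Elements of the values of a product-preserving homological functor -/

section Evaluation

variable {T : Type u} [Category.{w} T] (F : T ⥤ AddCommGrpCat.{v})

lemma map_comp_eval {X Y Z : T} (f : X ⟶ Y) (g : Y ⟶ Z) (x : F.obj X) :
    F.map (f ≫ g) x = F.map g (F.map f x) := by
  simp

lemma map_sub_eval [Preadditive T] [F.Additive] {X Y : T} (f g : X ⟶ Y) (x : F.obj X) :
    F.map (f - g) x = F.map f x - F.map g x := by
  rw [F.map_sub]; rfl

lemma map_add_eval [Preadditive T] [F.Additive] {X Y : T} (f g : X ⟶ Y) (x : F.obj X) :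
    F.map (f + g) x = F.map f x + F.map g x := by
  rw [F.map_add]; rfl

lemma map_zero_eval [Preadditive T] [F.Additive] (X Y : T) (x : F.obj X) :
    F.map (0 : X ⟶ Y) x = 0 := by
  rw [F.map_zero]; rfl

lemma exists_eval_eq_of_isLimit {J : Type v} {Y : J → T} [PreservesLimitsOfShape (Discrete J) F]
    {c : Fan Y} (hc : IsLimit c) (y : ∀ j, F.obj (Y j)) :
    ∃ x : F.obj c.pt, ∀ j, F.map (c.proj j) x = y j := by
  have hc' := isLimitOfPreserves (F ⋙ forget AddCommGrpCat.{v}) hc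
  refine ⟨(Types.isLimitEquivSections hc').symm ⟨fun j => y j.as, ?_⟩, fun j =>
    Types.isLimitEquivSections_symm_apply hc' _ ⟨j⟩⟩
  rintro ⟨j⟩ ⟨j'⟩ ⟨⟨h⟩⟩
  obtain rfl : j = j' := h
  exact congrArg (fun f => f (y j))
    ((Discrete.functor Y ⋙ F ⋙ forget AddCommGrpCat.{v}).map_id ⟨j⟩)

lemma eval_ext_of_isLimit {J : Type v} {Y : J → T} [PreservesLimitsOfShape (Discrete J) F]
    {c : Fan Y} (hc : IsLimit c) (x x' : F.obj c.pt)
    (h : ∀ j, F.map (c.proj j) x = F.map (c.proj j) x') : x = x' :=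
  Concrete.isLimit_ext _ (isLimitOfPreserves F hc) _ _ fun ⟨j⟩ => h j

variable [HasZeroObject T] [HasShift T ℤ] [Preadditive T]
  [∀ n : ℤ, (shiftFunctor T n).Additive] [Pretriangulated T]

lemma exists_eval_eq_of_distTriang [F.IsHomological] {X Y Z : T} {f : X ⟶ Y} {g : Y ⟶ Z}
    {h : Z ⟶ X⟦(1 : ℤ)⟧} (hT : Triangle.mk f g h ∈ distTriang T)
    (x : F.obj Y) (hx : F.map g x = 0) : ∃ y, F.map f y = x := by
  have := F.map_distinguished_exact _ hT
  rw [ShortComplex.ab_exact_iff] at this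
  exact this x hx

end Evaluation

end Functor

/-! ### Solvability and its closure properties -/

section Solution

variable {T : Type u} [Category.{w} T] (F : T ⥤ AddCommGrpCat.{v})

namespace Functor

/-- Every element of `F X`, for `X` satisfying `P`, is the image of `m` under some morphism
`M ⟶ X`. -/
def Covers {M : T} (m : F.obj M) (P : ObjectProperty T) : Prop :=
  ∀ ⦃X : T⦄, P X → ∀ x : F.obj X, ∃ f : M ⟶ X, F.map f m = x

/-- The morphism `φ : M' ⟶ M` kills every morphism from `M` to an object satisfying `P` which
annihilates `m`. -/
def Kills [HasZeroMorphisms T] {M' M : T} (φ : M' ⟶ M) (m : F.obj M) (P : ObjectProperty T) :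
    Prop :=
  ∀ ⦃X : T⦄, P X → ∀ f : M ⟶ X, F.map f m = 0 → φ ≫ f = 0

/-- `F` is solvable on the objects satisfying `P`: there is a pair `(M, m)` with `m : F M`
through which all elements of `F X` factor, for `X` satisfying `P`, and the relations on
such a pair are killed by passing to another pair. -/
structure IsSolvableOn [HasZeroMorphisms T] (P : ObjectProperty T) : Prop where
  exists_covers : ∃ (M : T) (m : F.obj M), F.Covers m P
  exists_kills {M : T} (m : F.obj M) :
    ∃ (M' : T) (m' : F.obj M') (φ : M' ⟶ M), F.map φ m' = m ∧ F.Kills φ m P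

variable {F}

lemma Covers.of_map_eq {M M' : T} {m : F.obj M} {m' : F.obj M'} {P : ObjectProperty T}
    (h : F.Covers m P) (φ : M' ⟶ M) (hφ : F.map φ m' = m) : F.Covers m' P := by
  intro X hX x
  obtain ⟨f, rfl⟩ := h hX x
  exact ⟨φ ≫ f, by rw [F.map_comp_eval, hφ]⟩

lemma IsSolvableOn.anti [HasZeroMorphisms T] {P Q : ObjectProperty T} (hQ : F.IsSolvableOn Q)
    (h : P ≤ Q) : F.IsSolvableOn P where
  exists_covers := by
    obtain ⟨M, m, hM⟩ := hQ.exists_covers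
    exact ⟨M, m, fun X hX => hM (h _ hX)⟩
  exists_kills m := by
    obtain ⟨M', m', φ, h₁, h₂⟩ := hQ.exists_kills m
    exact ⟨M', m', φ, h₁, fun X hX => h₂ (h _ hX)⟩

end Functor

namespace ObjectProperty

/-- The objects that are products, indexed by types in `Type v`, of objects satisfying `P`. -/
def smallProducts (P : ObjectProperty T) : ObjectProperty T := fun X =>
  ∃ (J : Type v) (Y : J → T) (π : ∀ j, X ⟶ Y j), Nonempty (IsLimit (Fan.mk X π)) ∧ ∀ j, P (Y j)

lemma smallProducts_monotone {P Q : ObjectProperty T} (h : P ≤ Q) :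
    smallProducts.{v} P ≤ smallProducts.{v} Q := by
  rintro X ⟨J, Y, π, hπ, hY⟩
  exact ⟨J, Y, π, hπ, fun j => h _ (hY j)⟩

lemma smallProducts_of_nat {P : ObjectProperty T} {X : T} {Y : ℕ → T} {π : ∀ n, X ⟶ Y n}
    (hπ : IsLimit (Fan.mk X π)) (hY : ∀ n, P (Y n)) : smallProducts.{v} P X :=
  ⟨ULift.{v} ℕ, fun n => Y n.down, fun n => π n.down,
    ⟨Fan.IsLimit.mk _ (fun s => Fan.IsLimit.lift hπ fun n => s.proj ⟨n⟩)
      (fun _ _ => Fan.IsLimit.fac _ _ _)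
      fun s _ hm => Fan.IsLimit.hom_ext hπ _ _ fun n => (hm ⟨n⟩).trans
        (Fan.IsLimit.fac hπ (fun n => s.proj ⟨n⟩) n).symm⟩,
    fun n => hY n.down⟩

instance smallProducts_isStableUnderShift [HasShift T ℤ] (P : ObjectProperty T)
    [P.IsStableUnderShift ℤ] : (smallProducts.{v} P).IsStableUnderShift ℤ where
  isStableUnderShiftBy n := ⟨by
    rintro X ⟨J, Y, π, ⟨hπ⟩, hY⟩
    exact ⟨J, fun j => (Y j)⟦n⟧, fun j => (π j)⟦n⟧',
      ⟨(isLimitMapConeFanMkEquiv (shiftFunctor T n) Y π) (isLimitOfPreserves _ hπ)⟩,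
      fun j => P.le_shift n _ (hY j)⟩⟩

end ObjectProperty

namespace Functor

variable {F} in
lemma IsSolvableOn.retractClosure [HasZeroMorphisms T] {P : ObjectProperty T} (hP : F.IsSolvableOn P) :
    F.IsSolvableOn P.retractClosure where
  exists_covers := by
    obtain ⟨M, m, hM⟩ := hP.exists_covers
    refine ⟨M, m, ?_⟩
    rintro X ⟨Y, hY, ⟨r⟩⟩ x
    obtain ⟨f, hf⟩ := hM hY (F.map r.i x)
    exact ⟨f ≫ r.r, by rw [F.map_comp_eval, hf, ← F.map_comp_eval, r.retract]; simp⟩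
  exists_kills m := by
    obtain ⟨M', m', φ, h₁, h₂⟩ := hP.exists_kills m
    refine ⟨M', m', φ, h₁, ?_⟩
    rintro X ⟨Y, hY, ⟨r⟩⟩ f hf
    have : φ ≫ f ≫ r.i = 0 := h₂ hY _ (by rw [F.map_comp_eval, hf, map_zero])
    rw [← Category.comp_id (φ ≫ f), ← r.retract, Category.assoc, reassoc_of% this, zero_comp]

variable [∀ J : Type v, PreservesLimitsOfShape (Discrete J) F]

variable {F} in
lemma IsSolvableOn.smallProducts [HasZeroMorphisms T] {P : ObjectProperty T} (hP : F.IsSolvableOn P) :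
    F.IsSolvableOn (ObjectProperty.smallProducts.{v} P) where
  exists_covers := by
    obtain ⟨M, m, hM⟩ := hP.exists_covers
    refine ⟨M, m, ?_⟩
    rintro X ⟨J, Y, π, ⟨hπ⟩, hY⟩ x
    choose f hf using fun j => hM (hY j) (F.map (π j) x)
    refine ⟨Fan.IsLimit.lift hπ f, F.eval_ext_of_isLimit hπ _ _ fun j => ?_⟩
    rw [← F.map_comp_eval]
    have := Fan.IsLimit.fac hπ f j
    refine Eq.trans ?_ (hf j)
    rw [← this]
  exists_kills m := by
    obtain ⟨M', m', φ, h₁, h₂⟩ := hP.exists_kills m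
    refine ⟨M', m', φ, h₁, ?_⟩
    rintro X ⟨J, Y, π, ⟨hπ⟩, hY⟩ f hf
    refine Fan.IsLimit.hom_ext hπ _ _ fun j => ?_
    rw [Category.assoc, zero_comp]
    exact h₂ (hY j) _ (by rw [F.map_comp_eval, hf, map_zero])

variable [HasProducts.{v} T]

lemma exists_eval_pi_eq {J : Type v} (Y : J → T) (y : ∀ j, F.obj (Y j)) :
    ∃ x : F.obj (∏ᶜ Y), ∀ j, F.map (Pi.π Y j) x = y j :=
  F.exists_eval_eq_of_isLimit (productIsProduct Y) y

lemma eval_pi_ext {J : Type v} {Y : J → T} (x x' : F.obj (∏ᶜ Y))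
    (h : ∀ j, F.map (Pi.π Y j) x = F.map (Pi.π Y j) x') : x = x' :=
  F.eval_ext_of_isLimit (productIsProduct Y) x x' h

variable [HasZeroObject T] [HasShift T ℤ] [Preadditive T]
  [∀ n : ℤ, (shiftFunctor T n).Additive] [Pretriangulated T]
  [F.IsHomological]

/-- A small family of morphisms annihilating `m` can be killed. -/
lemma exists_comp_eq_zero {J : Type v} {M : T} (m : F.obj M) (C : J → T) (ψ : ∀ j, M ⟶ C j)
    (hψ : ∀ j, F.map (ψ j) m = 0) :
    ∃ (M' : T) (m' : F.obj M') (φ : M' ⟶ M), F.map φ m' = m ∧ ∀ j, φ ≫ ψ j = 0 := by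
  obtain ⟨M', φ, δ, hT⟩ := distinguished_cocone_triangle₁ (Pi.lift ψ)
  obtain ⟨m', hm'⟩ := F.exists_eval_eq_of_distTriang hT m (F.eval_pi_ext _ _ fun j => by
    rw [← F.map_comp_eval, Pi.lift_π, hψ, map_zero])
  refine ⟨M', m', φ, hm', fun j => ?_⟩
  have : φ ≫ Pi.lift ψ = 0 := comp_distTriang_mor_zero₁₂ _ hT
  rw [← Pi.lift_π ψ j, reassoc_of% this, zero_comp]

/-- The generating element is the tuple of all elements of all `F.obj (G k)`. Local smallness makes
the relations on a given element a small family. -/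
lemma isSolvableOn_ofObj [LocallySmall.{v} T] {K : Type v} (G : K → T) :
    F.IsSolvableOn (ObjectProperty.ofObj G) where
  exists_covers := by
    obtain ⟨x, hx⟩ := F.exists_eval_pi_eq (fun a : Σ k, F.obj (G k) => G a.1) (fun a => a.2)
    refine ⟨_, x, ?_⟩
    rintro _ ⟨k⟩ y
    exact ⟨Pi.π (fun a : Σ k, F.obj (G k) => G a.1) ⟨k, y⟩, hx ⟨k, y⟩⟩
  exists_kills {M} m := by
    obtain ⟨M', m', φ, h₁, h₂⟩ := F.exists_comp_eq_zero m
      (fun a : Σ k, Shrink.{v} { f : M ⟶ G k // F.map f m = 0 } => G a.1)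
      (fun a => ((equivShrink _).symm a.2).1) (fun a => ((equivShrink _).symm a.2).2)
    refine ⟨M', m', φ, h₁, ?_⟩
    rintro _ ⟨k⟩ f hf
    simpa using h₂ ⟨k, equivShrink _ ⟨f, hf⟩⟩

variable {F}

lemma isSolvableOn_exists {J : Type v} {P : J → ObjectProperty T}
    (hP : ∀ j, F.IsSolvableOn (P j)) : F.IsSolvableOn (fun X => ∃ j, P j X) where
  exists_covers := by
    choose M m hM using fun j => (hP j).exists_covers
    obtain ⟨x, hx⟩ := F.exists_eval_pi_eq M m
    refine ⟨_, x, ?_⟩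
    rintro X ⟨j, hX⟩ y
    exact (hM j).of_map_eq _ (hx j) hX y
  exists_kills {M} m := by
    choose M' m' φ hφ hφ' using fun j => (hP j).exists_kills m
    -- Killing the maps to the cones of all `φ j` simultaneously makes the new map `χ` factor
    -- through every `φ j`.
    choose C ψ δ hT using fun j => distinguished_cocone_triangle (φ j)
    obtain ⟨N, n, χ, hχ, hχ'⟩ := F.exists_comp_eq_zero m C ψ fun j => by
      have : φ j ≫ ψ j = 0 := comp_distTriang_mor_zero₁₂ _ (hT j)
      rw [← hφ j, ← F.map_comp_eval, this, F.map_zero_eval]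
    refine ⟨N, n, χ, hχ, ?_⟩
    rintro X ⟨j, hX⟩ f hf
    obtain ⟨g, hg⟩ : ∃ g : N ⟶ M' j, χ = g ≫ φ j := Triangle.coyoneda_exact₂ _ (hT j) χ (hχ' j)
    rw [hg, Category.assoc, hφ' j hX f hf, comp_zero]

omit [F.IsHomological] in
lemma IsSolvableOn.exists_covers_kills {P : ObjectProperty T} (hP : F.IsSolvableOn P)
    {M : T} (m : F.obj M) : ∃ (M' : T) (m' : F.obj M') (φ : M' ⟶ M),
      F.map φ m' = m ∧ F.Covers m' P ∧ F.Kills φ m P := by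
  obtain ⟨M₀, m₀, h₀⟩ := hP.exists_covers
  obtain ⟨M₁, m₁, φ, hφ, hφ'⟩ := hP.exists_kills m
  obtain ⟨x, hx⟩ := F.exists_eval_pi_eq (fun b : ULift.{v} Bool => cond b.down M₀ M₁)
    (fun ⟨b⟩ => match b with | true => m₀ | false => m₁)
  have h0 : F.map (Pi.π (fun b : ULift.{v} Bool => cond b.down M₀ M₁) ⟨true⟩) x = m₀ := hx ⟨true⟩
  have h1 : F.map (Pi.π (fun b : ULift.{v} Bool => cond b.down M₀ M₁) ⟨false⟩) x = m₁ := hx ⟨false⟩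
  let p : ∏ᶜ (fun b : ULift.{v} Bool => cond b.down M₀ M₁) ⟶ M₁ :=
    Pi.π (fun b : ULift.{v} Bool => cond b.down M₀ M₁) ⟨false⟩
  refine ⟨_, x, p ≫ φ, ?_, h₀.of_map_eq _ h0, fun X hX f hf => ?_⟩
  · rw [F.map_comp_eval, ← hφ]
    exact congrArg _ h1
  · rw [Category.assoc, hφ' hX f hf, comp_zero]

/-- A diagram chase along A ⟶ X ⟶ B ⟶ A⟦1⟧ in which each obstruction is a relation valued in the
union `R` of the two classes and disappears after one further refinement of `M`. Stability under
shifts keeps A⟦1⟧ and B⟦-1⟧ inside `R`. -/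
lemma IsSolvableOn.extensionProduct {P Q : ObjectProperty T} [P.IsStableUnderShift ℤ]
    [Q.IsStableUnderShift ℤ] (hP : F.IsSolvableOn P) (hQ : F.IsSolvableOn Q) :
    F.IsSolvableOn (P.extensionProduct Q) := by
  have hR : F.IsSolvableOn (fun X => ∃ b : ULift.{v} Bool, (cond b.down P Q) X) :=
    isSolvableOn_exists (by rintro ⟨_ | _⟩ <;> assumption)
  set R : ObjectProperty T := fun X => ∃ b : ULift.{v} Bool, (cond b.down P Q) X with hR'
  have hPR : P ≤ R := fun X hX => ⟨⟨true⟩, hX⟩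
  have hQR : Q ≤ R := fun X hX => ⟨⟨false⟩, hX⟩
  constructor
  · obtain ⟨M₀, m₀, h₀⟩ := hR.exists_covers
    obtain ⟨M, m, φ, hφ, hM, hφ'⟩ := hR.exists_covers_kills m₀
    refine ⟨M, m, ?_⟩
    rintro X ⟨A, B, a, b, δ, hT, hA, hB⟩ x
    obtain ⟨f, hf⟩ := h₀ (hQR _ hB) (F.map b x)
    have hb : φ ≫ f ≫ δ = 0 := hφ' (hPR _ (P.le_shift 1 _ hA)) _ (by
      have : b ≫ δ = 0 := comp_distTriang_mor_zero₂₃ _ hT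
      rw [F.map_comp_eval, hf, ← F.map_comp_eval, this, F.map_zero_eval])
    obtain ⟨g, hg⟩ : ∃ g : M ⟶ X, φ ≫ f = g ≫ b :=
      Triangle.coyoneda_exact₃ _ hT (φ ≫ f) ((Category.assoc _ _ _).trans hb)
    obtain ⟨y, hy⟩ := F.exists_eval_eq_of_distTriang hT (x - F.map g m) (by
      rw [_root_.map_sub, ← F.map_comp_eval, ← hg, F.map_comp_eval, hφ, hf, sub_self])
    -- The error `x - F.map g m` comes from A, where `m` again generates.
    obtain ⟨h, rfl⟩ := hM (hPR _ hA) y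
    refine ⟨g + h ≫ a, ?_⟩
    rw [F.map_add_eval, F.map_comp_eval, hy, add_sub_cancel]
  · intro M m
    obtain ⟨M₁, m₁, φ₁, hm₁, hc₁, hk₁⟩ := hR.exists_covers_kills m
    obtain ⟨M₂, m₂, φ₂, hm₂, hk₂⟩ := hR.exists_kills m₁
    refine ⟨M₂, m₂, φ₂ ≫ φ₁, by rw [F.map_comp_eval, hm₂, hm₁], ?_⟩
    rintro X ⟨A, B, a, b, δ, hT, hA, hB⟩ f hf
    have hb : φ₁ ≫ f ≫ b = 0 := hk₁ (hQR _ hB) _ (by rw [F.map_comp_eval, hf, map_zero])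
    obtain ⟨g, hg⟩ : ∃ g : M₁ ⟶ A, φ₁ ≫ f = g ≫ a :=
      Triangle.coyoneda_exact₂ _ hT (φ₁ ≫ f) ((Category.assoc _ _ _).trans hb)
    obtain ⟨d, b', hT'⟩ : ∃ (d : B⟦(-1 : ℤ)⟧ ⟶ A) (b' : X ⟶ B⟦(-1 : ℤ)⟧⟦(1 : ℤ)⟧),
        Triangle.mk d a b' ∈ distTriang T := ⟨_, _, inv_rot_of_distTriang _ hT⟩
    have hda : d ≫ a = 0 := comp_distTriang_mor_zero₁₂ _ hT'
    obtain ⟨y, hy⟩ := F.exists_eval_eq_of_distTriang hT' (F.map g m₁) (by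
      rw [← F.map_comp_eval, ← hg, F.map_comp_eval, hm₁, hf])
    obtain ⟨h, rfl⟩ := hc₁ (hQR _ (Q.le_shift (-1) _ hB)) y
    -- `g` itself need not annihilate `m₁`; subtracting `h ≫ d` achieves this without changing the
    -- composite with `a`.
    rw [← F.map_comp_eval] at hy
    have h0 := hk₂ (hPR _ hA) (g - h ≫ d) (by
      rw [F.map_sub_eval, hy, sub_self])
    have : (g - h ≫ d) ≫ a = φ₁ ≫ f := by
      rw [Preadditive.sub_comp, ← hg, Category.assoc, hda, comp_zero, sub_zero]
    rw [Category.assoc, ← this, reassoc_of% h0, zero_comp]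

lemma IsSolvableOn.extensionProductIter {P : ObjectProperty T} [P.IsStableUnderShift ℤ]
    (hP : F.IsSolvableOn P) (n : ℕ) : F.IsSolvableOn (P.extensionProductIter n) := by
  induction n with
  | zero => exact hP
  | succ n ih =>
    rw [ObjectProperty.extensionProductIter_succ]
    exact hP.extensionProduct ih

omit [∀ J : Type v, PreservesLimitsOfShape (Discrete J) F] [HasProducts.{v} T] in
/-- A homological functor which is solvable on all objects is corepresentable. -/
lemma IsSolvableOn.exists_equiv [IsIdempotentComplete T] (h : F.IsSolvableOn ⊤) :
    ∃ (X : T) (e : ∀ Y : T, (X ⟶ Y) ≃+ F.obj Y),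
      ∀ (Y Z : T) (g : Y ⟶ Z) (f : X ⟶ Y), e Z (f ≫ g) = F.map g (e Y f) := by
  obtain ⟨M, m, hM⟩ := h.exists_covers
  obtain ⟨M', m', φ, hm', hφ⟩ := h.exists_kills m
  obtain ⟨s, hs⟩ := hM (X := M') trivial m'
  -- Since `s` sends `m` to `m'` and `φ` sends `m'` to `m`, the map `s ≫ φ ≫ s - s` annihilates `m`,
  -- so `φ` kills it and `φ ≫ s` is idempotent.
  obtain ⟨X, i, r, hir, hri⟩ := IsIdempotentComplete.idempotents_split M' (φ ≫ s) (by
    have := hφ (X := M') trivial (s ≫ φ ≫ s - s) (by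
      rw [F.map_sub_eval, F.map_comp_eval, F.map_comp_eval, hs, hm', hs, sub_self])
    rw [Preadditive.comp_sub, sub_eq_zero] at this
    simpa using this)
  have hx : F.map i (F.map r m') = m' := by
    rw [← F.map_comp_eval, hri, F.map_comp_eval, hm', hs]
  refine ⟨X, fun Y => AddEquiv.ofBijective
    (AddMonoidHom.mk' (fun f : X ⟶ Y => F.map f (F.map r m')) fun f g => F.map_add_eval f g _)
    ⟨?_, fun y => ?_⟩, fun Y Z g f => F.map_comp_eval f g _⟩
  · rw [injective_iff_map_eq_zero]
    intro g hg
    replace hg : F.map g (F.map r m') = 0 := hg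
    have := hφ (X := Y) trivial (s ≫ r ≫ g) (by
      rw [F.map_comp_eval, hs, F.map_comp_eval, hg])
    rw [← Category.id_comp g, ← hir, ← Category.id_comp i, ← hir]
    simp only [Category.assoc]
    rw [reassoc_of% hri, this, comp_zero]
  · obtain ⟨f, rfl⟩ := hM (X := Y) trivial y
    refine ⟨i ≫ φ ≫ f, ?_⟩
    change F.map (i ≫ φ ≫ f) (F.map r m') = _
    rw [F.map_comp_eval, hx, F.map_comp_eval, hm']

end Functor

end Solution

end CategoryTheory

end

/-! ### Inverse towers and splitting of idempotents -/

noncomputable section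

namespace CategoryTheory

section SplitTower

variable {C : Type u} [Category.{w} C] [Preadditive C]

/-- The endomorphism `1 - shift` of the product of an inverse tower. -/
def oneSubShift (X : ℕ → C) [HasProduct X] (t : ∀ n, X (n + 1) ⟶ X n) : ∏ᶜ X ⟶ ∏ᶜ X :=
  𝟙 (∏ᶜ X) - Pi.lift fun n => Pi.π X (n + 1) ≫ t n

lemma oneSubShift_π (X : ℕ → C) [HasProduct X] (t : ∀ n, X (n + 1) ⟶ X n) (n : ℕ) :
    oneSubShift X t ≫ Pi.π X n = Pi.π X n - Pi.π X (n + 1) ≫ t n := by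
  simp [oneSubShift]

lemma comp_oneSubShift_eq_zero_iff {X : ℕ → C} [HasProduct X] (t : ∀ n, X (n + 1) ⟶ X n)
    {W : C} (f : W ⟶ ∏ᶜ X) :
    f ≫ oneSubShift X t = 0 ↔ ∀ n, f ≫ Pi.π X n = (f ≫ Pi.π X (n + 1)) ≫ t n := by
  refine ⟨fun h n => ?_, fun h => Pi.hom_ext _ _ fun n => ?_⟩
  · rw [← sub_eq_zero, Category.assoc, ← Preadditive.comp_sub, ← oneSubShift_π, reassoc_of% h,
      zero_comp]
  · rw [Category.assoc, oneSubShift_π, Preadditive.comp_sub, h, Category.assoc, sub_self,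
      zero_comp]

/-- The recursively defined components of a section of `1 - shift` for a tower of split
epimorphisms. -/
def oneSubShiftSectionπ {X : ℕ → C} (c : Fan X) (s : ∀ n, X n ⟶ X (n + 1)) :
    ∀ n, c.pt ⟶ X n
  | 0 => 0
  | n + 1 => (oneSubShiftSectionπ c s n - c.proj n) ≫ s n

lemma isSplitEpi_of_isLimit {X : ℕ → C} {c : Fan X} (hc : IsLimit c) (t : ∀ n, X (n + 1) ⟶ X n)
    [∀ n, IsSplitEpi (t n)] (D : c.pt ⟶ c.pt)
    (hD : ∀ n, D ≫ c.proj n = c.proj n - c.proj (n + 1) ≫ t n) : IsSplitEpi D := by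
  have h (n : ℕ) : Fan.IsLimit.lift hc (oneSubShiftSectionπ c fun n => section_ (t n)) ≫
      c.proj n = oneSubShiftSectionπ c (fun n => section_ (t n)) n := Fan.IsLimit.fac _ _ _
  refine ⟨⟨Fan.IsLimit.lift hc (oneSubShiftSectionπ c fun n => section_ (t n)),
    Fan.IsLimit.hom_ext hc _ _ fun n => ?_⟩⟩
  rw [Category.assoc, hD, Preadditive.comp_sub, reassoc_of% h, h, oneSubShiftSectionπ]
  simp

/-- Morally the tower is the sum of a constant tower on the image of `e`, where the section is
recursive, and a zero tower on the complement, where 1 - shift is the identity. The formula does not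
need the splitting to exist. -/
lemma isSplitEpi_oneSubShift_of_idem (P : C) [HasProduct fun _ : ℕ => P] (e : P ⟶ P)
    (he : e ≫ e = e) : IsSplitEpi (oneSubShift (fun _ : ℕ => P) fun _ => e) := by
  let σ : ∀ _ : ℕ, (∏ᶜ fun _ : ℕ => P) ⟶ P :=
    oneSubShiftSectionπ (Fan.mk _ (Pi.π fun _ : ℕ => P)) fun _ => e
  have hσ (n : ℕ) : σ (n + 1) = (σ n - Pi.π (fun _ : ℕ => P) n) ≫ e := rfl
  have h (n : ℕ) : σ n ≫ e = σ n := by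
    cases n with
    | zero => exact zero_comp
    | succ n => rw [hσ, Category.assoc, he]
  refine ⟨⟨Pi.lift fun n => σ n + Pi.π (fun _ : ℕ => P) n ≫ (𝟙 P - e), Pi.hom_ext _ _ fun n => ?_⟩⟩
  simp [oneSubShift_π, hσ, he, h, Preadditive.comp_sub, Preadditive.sub_comp]

end SplitTower

/-- Idempotents split in a pretriangulated category with countable products. -/
lemma isIdempotentComplete_of_hasProducts (T : Type u) [Category.{w} T] [HasZeroObject T]
    [HasShift T ℤ] [Preadditive T] [∀ n : ℤ, (shiftFunctor T n).Additive] [Pretriangulated T]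
    [HasProducts.{0} T] : IsIdempotentComplete T where
  idempotents_split P e he := by
    have := isSplitEpi_oneSubShift_of_idem P e he
    obtain ⟨Y, i, δ, hT⟩ :=
      distinguished_cocone_triangle₁ (oneSubShift (fun _ : ℕ => P) fun _ => e)
    have hδ : δ = 0 := Triangle.mor₃_eq_zero_of_epi₂ _ hT (inferInstanceAs (Epi (oneSubShift _ _)))
    have : Mono i := Triangle.mono₁ _ hT hδ
    have hi : i ≫ oneSubShift (fun _ : ℕ => P) (fun _ => e) = 0 := comp_distTriang_mor_zero₁₂ _ hT
    -- The homotopy limit `Y` is now a genuine kernel: its components all agree and are fixed by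
    -- `e`, so `Y` is the image of `e`.
    have hi' := (comp_oneSubShift_eq_zero_iff _ _).1 hi
    have hie (n : ℕ) : (i ≫ Pi.π (fun _ : ℕ => P) n) ≫ e = i ≫ Pi.π (fun _ : ℕ => P) n := by
      rw [hi' n, Category.assoc, he]
    have hi0 (n : ℕ) : i ≫ Pi.π (fun _ : ℕ => P) n = i ≫ Pi.π (fun _ : ℕ => P) 0 := by
      induction n with
      | zero => rfl
      | succ n ih => rw [← ih, hi' n, hie]
    obtain ⟨r, hr⟩ : ∃ r : P ⟶ Y, Pi.lift (fun _ : ℕ => e) = r ≫ i :=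
      Triangle.coyoneda_exact₂ _ hT (Pi.lift fun _ : ℕ => e)
        ((comp_oneSubShift_eq_zero_iff _ _).2 fun n => by simp [he])
    refine ⟨Y, i ≫ Pi.π (fun _ : ℕ => P) 0, r, ?_, ?_⟩
    · rw [← cancel_mono i, Category.assoc, ← hr]
      refine Pi.hom_ext _ _ fun n => ?_
      rw [Category.assoc, Pi.lift_π, hie, Category.id_comp]
      exact (hi0 n).symm
    · rw [← reassoc_of% hr, Pi.lift_π]

end CategoryTheory

end

/-! ### Products of K-injective complexes -/

noncomputable section

namespace CochainComplex

variable {A : Type u} [Category.{v} A] [Abelian A]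

section Products

variable {J : Type*} {I : J → CochainComplex A ℤ} {c : Fan I}

/-- A morphism to a product of complexes is homotopic to zero if its components are. -/
lemma nonempty_homotopy_zero_of_isLimit [HasLimitsOfShape (Discrete J) A] (hc : IsLimit c)
    {K : CochainComplex A ℤ} (f : K ⟶ c.pt)
    (h : ∀ j, Nonempty (Homotopy (f ≫ c.proj j) 0)) : Nonempty (Homotopy f 0) := by
  replace h := fun j => (h j).some
  have hc' (i : ℤ) : IsLimit (Fan.mk (c.pt.X i) fun j => (c.proj j).f i) :=
    isLimitMapConeFanMkEquiv (HomologicalComplex.eval A (ComplexShape.up ℤ) i) I c.proj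
      (isLimitOfPreserves (HomologicalComplex.eval A (ComplexShape.up ℤ) i)
        (IsLimit.ofIsoLimit hc (Fan.ext (Iso.refl _))))
  let l (i k : ℤ) : K.X i ⟶ c.pt.X k := Fan.IsLimit.lift (hc' k) fun j => (h j).hom i k
  have hl (i k : ℤ) (j : J) : l i k ≫ (c.proj j).f k = (h j).hom i k := Fan.IsLimit.fac _ _ _
  refine ⟨⟨l, fun i k hik => Fan.IsLimit.hom_ext (hc' k) _ _ fun j => ?_,
    fun i => Fan.IsLimit.hom_ext (hc' i) _ _ fun j => ?_⟩⟩
  · refine (hl i k j).trans ?_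
    rw [(h j).zero i k hik, zero_comp]
  · have := (h j).comm i
    rw [dNext_eq _ (show (ComplexShape.up ℤ).Rel i (i + 1) from rfl),
      prevD_eq _ (show (ComplexShape.up ℤ).Rel (i - 1) i by simp)] at this ⊢
    simp only [HomologicalComplex.comp_f, HomologicalComplex.zero_f, add_zero] at this ⊢
    refine this.trans ?_
    change _ = (_ + _) ≫ (c.proj j).f i
    rw [Preadditive.add_comp, Category.assoc, Category.assoc, hl,
      ← HomologicalComplex.Hom.comm, reassoc_of% hl]

lemma isKInjective_of_isLimit [HasLimitsOfShape (Discrete J) A] (hc : IsLimit c)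
    (hI : ∀ j, (I j).IsKInjective) : c.pt.IsKInjective where
  nonempty_homotopy_zero f hK :=
    nonempty_homotopy_zero_of_isLimit hc f fun _ => IsKInjective.nonempty_homotopy_zero _ hK

variable [HasDerivedCategory.{w} A]

lemma Q_map_surjective_of_isKInjective (K L : CochainComplex A ℤ) [L.IsKInjective] :
    Function.Surjective (DerivedCategory.Q.map : (K ⟶ L) → _) := by
  intro g
  obtain ⟨f, hf⟩ := (IsKInjective.Qh_map_bijective ((HomotopyCategory.quotient _ _).obj K) L).2
    ((DerivedCategory.quotientCompQhIso A).hom.app K ≫ g ≫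
      (DerivedCategory.quotientCompQhIso A).inv.app L)
  obtain ⟨f, rfl⟩ := (HomotopyCategory.quotient _ _).map_surjective f
  refine ⟨f, ?_⟩
  rw [← cancel_epi ((DerivedCategory.quotientCompQhIso A).hom.app K),
    ← DerivedCategory.quotientCompQhIso_hom_naturality, hf]
  simp

lemma nonempty_homotopy_zero_of_Q_map_eq_zero {K L : CochainComplex A ℤ} [L.IsKInjective]
    (f : K ⟶ L) (hf : DerivedCategory.Q.map f = 0) : Nonempty (Homotopy f 0) := by
  refine ⟨HomotopyCategory.homotopyOfEq _ _
    ((IsKInjective.Qh_map_bijective ((HomotopyCategory.quotient _ _).obj K) L).1 ?_)⟩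
  rw [← cancel_mono ((DerivedCategory.quotientCompQhIso A).hom.app L),
    DerivedCategory.quotientCompQhIso_hom_naturality, hf]
  simp

/-- The localization functor preserves products of K-injective complexes. -/
lemma nonempty_isLimit_Q_of_isKInjective [HasLimitsOfShape (Discrete J) A] (hc : IsLimit c)
    (hI : ∀ j, (I j).IsKInjective) :
    Nonempty (IsLimit (Fan.mk (DerivedCategory.Q.obj c.pt)
      fun j => DerivedCategory.Q.map (c.proj j))) := by
  have := isKInjective_of_isLimit hc hI
  have lift (s : Fan fun j => DerivedCategory.Q.obj (I j)) :
      ∃ l : s.pt ⟶ DerivedCategory.Q.obj c.pt,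
        ∀ j, l ≫ DerivedCategory.Q.map (c.proj j) = s.proj j := by
    let e := DerivedCategory.Q.objObjPreimageIso s.pt
    choose g hg using fun j => Q_map_surjective_of_isKInjective _ (I j) (e.hom ≫ s.proj j)
    refine ⟨e.inv ≫ DerivedCategory.Q.map (Fan.IsLimit.lift hc g), fun j => ?_⟩
    rw [Category.assoc, ← Functor.map_comp, Fan.IsLimit.fac, hg, e.inv_hom_id_assoc]
  choose l hl using lift
  refine ⟨Fan.IsLimit.mk _ l hl fun s m hm => ?_⟩
  let e := DerivedCategory.Q.objObjPreimageIso s.pt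
  obtain ⟨f, hf⟩ := Q_map_surjective_of_isKInjective _ c.pt (e.hom ≫ ((show s.pt ⟶ DerivedCategory.Q.obj c.pt from m) - l s))
  obtain ⟨h⟩ := nonempty_homotopy_zero_of_isLimit hc f fun j =>
    nonempty_homotopy_zero_of_Q_map_eq_zero _ (by
      have h1 : m ≫ DerivedCategory.Q.map (c.proj j) = s.proj j := hm j
      rw [Functor.map_comp, hf, Category.assoc, Preadditive.sub_comp, h1, hl, sub_self,
        comp_zero])
  rw [← sub_eq_zero, ← cancel_epi e.hom]
  refine hf.symm.trans ?_
  rw [DerivedCategory.Q_map_eq_of_homotopy _ h]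
  simp

end Products

end CochainComplex

/-! ### Objects of the derived category with K-injective resolutions -/

namespace CategoryTheory

variable {A : Type u} [Category.{v} A] [Abelian A]

section
variable [HasDerivedCategory.{w} A]

instance : ((homotopicallyInjective A).ι ⋙ DerivedCategory.Qh).Full where
  map_surjective {X Y} g := by
    obtain ⟨f, hf⟩ := (Y.property.map_bijective_of_isTriangulated DerivedCategory.Qh X.obj).2 g
    exact ⟨ObjectProperty.homMk f, hf⟩

instance : ((homotopicallyInjective A).ι ⋙ DerivedCategory.Qh).Faithful where
  map_injective {X Y f g} h := by
    ext
    exact (Y.property.map_bijective_of_isTriangulated DerivedCategory.Qh X.obj).1 h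

variable (A) in
/-- The objects of the derived category that are isomorphic to K-injective complexes. -/
abbrev hasKInjectiveResolution : ObjectProperty (DerivedCategory A) :=
  ((homotopicallyInjective A).ι ⋙ DerivedCategory.Qh).essImage

instance : (hasKInjectiveResolution A).IsTriangulated := inferInstance

lemma hasKInjectiveResolution_iff (X : DerivedCategory A) :
    hasKInjectiveResolution A X ↔ ∃ (I : CochainComplex A ℤ), I.IsKInjective ∧
      Nonempty (X ≅ DerivedCategory.Q.obj I) := by
  constructor
  · rintro ⟨⟨K, hK⟩, ⟨e⟩⟩
    obtain ⟨I, rfl⟩ := HomotopyCategory.quotient_obj_surjective K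
    exact ⟨I, (CochainComplex.isKInjective_iff_rightOrthogonal I).2 hK,
      ⟨e.symm ≪≫ (DerivedCategory.quotientCompQhIso A).app I⟩⟩
  · rintro ⟨I, hI, ⟨e⟩⟩
    exact ⟨⟨_, (CochainComplex.isKInjective_iff_rightOrthogonal I).1 hI⟩,
      ⟨(DerivedCategory.quotientCompQhIso A).app I ≪≫ e.symm⟩⟩

lemma smallProducts_hasKInjectiveResolution_le [HasProducts.{v} A] :
    ObjectProperty.smallProducts.{v} (hasKInjectiveResolution A) ≤ hasKInjectiveResolution A := by
  rintro X ⟨J, Y, π, ⟨hπ⟩, hY⟩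
  simp only [hasKInjectiveResolution_iff] at hY ⊢
  choose I hI e using hY
  have hc := productIsProduct I
  obtain ⟨hc'⟩ := CochainComplex.nonempty_isLimit_Q_of_isKInjective hc hI
  exact ⟨_, CochainComplex.isKInjective_of_isLimit hc hI,
    ⟨IsLimit.conePointsIsoOfNatIso hπ hc' (Discrete.natIso fun j => (e j.as).some)⟩⟩

end

end CategoryTheory

end

/-! ### Enough injectives and resolutions from left-completeness -/

noncomputable section

namespace CategoryTheory

lemma IsCoseparator.mono_pi_lift {C : Type u} [Category.{v} C] {Q : C} (hQ : IsCoseparator Q)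
    (X : C) [HasProduct fun _ : X ⟶ Q => Q] : Mono (Pi.lift fun f : X ⟶ Q => f) :=
  ⟨fun g h hgh => hQ.def g h fun f => by
    have := hgh =≫ Pi.π (fun _ : X ⟶ Q => Q) f
    simpa using this⟩

lemma enoughInjectives_of_isCoseparator {C : Type u} [Category.{v} C] [HasProducts.{v} C]
    (Q : C) [Injective Q] (hQ : IsCoseparator Q) : EnoughInjectives C where
  presentation X := ⟨{
    J := ∏ᶜ fun _ : X ⟶ Q => Q
    f := Pi.lift fun f => f
    mono := hQ.mono_pi_lift X }⟩

end CategoryTheory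

namespace CochainComplex

variable {A : Type u} [Category.{v} A] [Abelian A]

lemma isIso_ιTruncLE_f (X : CochainComplex A ℤ) (m i : ℤ) (h : i < m) :
    IsIso ((X.ιTruncLE m).f i) := by
  let e := ComplexShape.embeddingUpIntLE m
  have hi : e.f (m - i).natAbs = i := by
    change m - ((m - i).natAbs : ℤ) = i
    lia
  have : ¬ e.op.BoundaryGE (m - i).natAbs := by
    rw [ComplexShape.Embedding.op_boundaryGE_iff,
      ComplexShape.boundaryLE_embeddingUpIntLE_iff]
    lia
  have : IsIso ((HomologicalComplex.πTruncGE (HomologicalComplex.op X) e.op).f i) := by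
    exact (e.op.isIso_liftExtend_f_iff _ _ hi).2
      (HomologicalComplex.isIso_restrictionToTruncGE' _ _ _ this)
  exact inferInstanceAs
    (IsIso ((HomologicalComplex.πTruncGE (HomologicalComplex.op X) e.op).f i).unop)

instance (X : CochainComplex A ℤ) (m : ℤ) : (X.quotTruncGE m).IsStrictlyGE (m - 1) := by
  rw [isStrictlyGE_iff]
  intro i hi
  have := isIso_ιTruncLE_f X (m - 1) i hi
  have h : X.ιTruncLE (m - 1) ≫ X.quotTruncGEπ m = 0 := cokernel.condition _
  have : Epi (X.quotTruncGEπ m) := inferInstanceAs (Epi (cokernel.π _))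
  have h' : (X.quotTruncGEπ m).f i = 0 := by
    rw [← cancel_epi ((X.ιTruncLE (m - 1)).f i), ← HomologicalComplex.comp_f, h]
    simp
  rw [IsZero.iff_id_eq_zero, ← cancel_epi ((X.quotTruncGEπ m).f i), h', zero_comp, zero_comp]

end CochainComplex

namespace CategoryTheory

variable {A : Type u} [Category.{v} A] [Abelian A] [HasDerivedCategory.{w} A]

variable (A) in
/-- The objects of the derived category that are isomorphic to bounded below complexes of
injective objects. -/
def boundedBelowInjective : ObjectProperty (DerivedCategory A) := fun X =>
  ∃ (I : CochainComplex A ℤ) (d : ℤ), I.IsStrictlyGE d ∧ (∀ i, Injective (I.X i)) ∧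
    Nonempty (X ≅ DerivedCategory.Q.obj I)

instance : (boundedBelowInjective A).IsStableUnderShift ℤ where
  isStableUnderShiftBy n := ⟨by
    rintro X ⟨I, d, _, hI, ⟨e⟩⟩
    exact ⟨I⟦n⟧, d - n, I.isStrictlyGE_shift d n _ (by lia), fun i => hI (i + n),
      ⟨(shiftFunctor _ n).mapIso e ≪≫ ((DerivedCategory.Q.commShiftIso n).app I).symm⟩⟩⟩

lemma boundedBelowInjective_le : boundedBelowInjective A ≤ hasKInjectiveResolution A := by
  rintro X ⟨I, d, _, hI, e⟩
  exact (hasKInjectiveResolution_iff X).2 ⟨I, CochainComplex.isKInjective_of_injective I d, e⟩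

lemma boundedBelowInjective_of_isStrictlyGE [EnoughInjectives A] (X : CochainComplex A ℤ) (d : ℤ)
    [X.IsStrictlyGE d] : boundedBelowInjective A (DerivedCategory.Q.obj X) := by
  obtain ⟨I, i, _, hI, _⟩ :=
    CochainComplex.Plus.modelCategoryQuillen.exists_quasiIso_injective X d
  exact ⟨I, d, inferInstance, hI, ⟨asIso (DerivedCategory.Q.map i)⟩⟩

/-- Rotating the defining triangle exhibits `Y` as an extension of the product by its own shift by
-1. -/
lemma extensionProduct_smallProducts_of_isHomotopyLimit {T : Type u} [Category.{w} T]
    [HasZeroObject T] [HasShift T ℤ] [Preadditive T] [∀ n : ℤ, (shiftFunctor T n).Additive]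
    [Pretriangulated T] {P : ObjectProperty T} [P.IsStableUnderShift ℤ] {X : ℕ → T} [HasProduct X]
    (hX : ∀ n, P (X n)) {φ : ∀ n, X (n + 1) ⟶ X n} {Y : T} (hY : IsHomotopyLimit X φ Y) :
    ((ObjectProperty.smallProducts.{v} P).extensionProduct (.smallProducts.{v} P)) Y := by
  obtain ⟨p, δ, hT⟩ := hY
  have h : ObjectProperty.smallProducts.{v} P (∏ᶜ X) := 
    ObjectProperty.smallProducts_of_nat (productIsProduct X) hX
  exact ⟨_, _, _, _, _, inv_rot_of_distTriang _ hT, ObjectProperty.le_shift _ (-1) _ h, h⟩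

lemma extensionProduct_smallProducts_boundedBelowInjective [EnoughInjectives A]
    (hA : IsLeftCompleteDerivedCategory A) (X : DerivedCategory A) :
    ((ObjectProperty.smallProducts.{v} (boundedBelowInjective A)).extensionProduct
      (.smallProducts.{v} (boundedBelowInjective A))) X := by
  obtain ⟨_, h⟩ := hA
  have : HasProducts.{0} (DerivedCategory A) := has_smallest_products_of_hasProducts.{v}
  refine ObjectProperty.prop_of_iso _ (DerivedCategory.Q.objObjPreimageIso X)
    (extensionProduct_smallProducts_of_isHomotopyLimit (fun n => ?_) (h _))
  exact boundedBelowInjective_of_isStrictlyGE _ (-(n : ℤ) - 1)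

lemma hasKInjectiveResolution_of_isLeftComplete [HasProducts.{v} A] [EnoughInjectives A]
    (hA : IsLeftCompleteDerivedCategory A) (X : DerivedCategory A) :
    hasKInjectiveResolution A X := by
  obtain ⟨Y, Z, f, g, δ, hT, hY, hZ⟩ :=
    extensionProduct_smallProducts_boundedBelowInjective hA X
  have h := ObjectProperty.smallProducts_monotone.{v} (boundedBelowInjective_le (A := A))
  exact ObjectProperty.ext_of_isTriangulatedClosed₂ _ _ hT
    (smallProducts_hasKInjectiveResolution_le _ (h _ hY))
    (smallProducts_hasKInjectiveResolution_le _ (h _ hZ))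

lemma exists_quasiIso_homotopicallyInjective (X : HomotopyCategory A (ComplexShape.up ℤ))
    (hX : hasKInjectiveResolution A (DerivedCategory.Qh.obj X)) :
    ∃ (E : HomotopyCategory A (ComplexShape.up ℤ)) (f : X ⟶ E),
      homotopicallyInjective A E ∧ HomotopyCategory.quasiIso A (ComplexShape.up ℤ) f := by
  obtain ⟨⟨E, hE⟩, ⟨e⟩⟩ := hX
  obtain ⟨f, hf⟩ := (hE.map_bijective_of_isTriangulated DerivedCategory.Qh X).2 e.inv
  have : IsIso (DerivedCategory.Qh.map f) := by rw [hf]; infer_instance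
  refine ⟨E, f, hE, ?_⟩
  rwa [← DerivedCategory.isIso_Qh_map_iff]

/-- Replacing the target by a K-injective embeds each Hom-set into one of K(A), which is small. -/
lemma locallySmall_derivedCategory (h : hasKInjectiveResolution A = ⊤) :
    LocallySmall.{v} (DerivedCategory A) where
  hom_small X Y := by
    obtain ⟨E, ⟨e⟩⟩ : hasKInjectiveResolution A Y := by rw [h]; trivial
    let e' := DerivedCategory.Qh.objObjPreimageIso X
    exact small_of_injective (β := DerivedCategory.Qh.objPreimage X ⟶ E.obj)
      (f := fun g => (Equiv.ofBijective _
        (E.property.map_bijective_of_isTriangulated DerivedCategory.Qh _)).symm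
          (e'.hom ≫ g ≫ e.inv)) fun g g' hg => by simpa using hg

end CategoryTheory

end

/-! ### The right adjoint of localization and derived functors -/

noncomputable section

namespace CategoryTheory

namespace Adjunction

variable {C D H : Type*} [Category* C] [Category* D] [Category* H] {L : C ⥤ D} {R : D ⥤ C}

/-- The natural transformation `H ⟶ L ⋙ R ⋙ H` induced by the unit of an adjunction `L ⊣ R`. -/
def unitWhiskerRight (adj : L ⊣ R) (K : C ⥤ H) : K ⟶ L ⋙ R ⋙ K :=
  K.leftUnitor.inv ≫ Functor.whiskerRight adj.unit K ≫ (Functor.associator L R K).hom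

/-- If `L ⊣ R`, then `R ⋙ K` is the left Kan extension of `K` along `L`. -/
lemma isLeftKanExtension_unitWhiskerRight (adj : L ⊣ R) (K : C ⥤ H) :
    (R ⋙ K).IsLeftKanExtension (adj.unitWhiskerRight K) := by
  let desc (E : Functor.LeftExtension L K) : R ⋙ K ⟶ E.right :=
    { app := fun Y => E.hom.app (R.obj Y) ≫ E.right.map (adj.counit.app Y)
      naturality := fun Y Z f => by
        have h := E.hom.naturality (R.map f)
        dsimp at h ⊢
        rw [reassoc_of% h, Category.assoc, ← Functor.map_comp, ← Functor.map_comp,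
          adj.counit_naturality] }
  refine ⟨⟨IsInitial.ofUniqueHom (fun E => StructuredArrow.homMk (desc E) ?_) fun E m => ?_⟩⟩
  · ext X
    have h := E.hom.naturality (adj.unit.app X)
    dsimp at h
    change (𝟙 _ ≫ K.map (adj.unit.app X) ≫ 𝟙 _) ≫ E.hom.app (R.obj (L.obj X)) ≫
      E.right.map (adj.counit.app (L.obj X)) = _
    rw [Category.id_comp, Category.comp_id, reassoc_of% h, ← Functor.map_comp,
      adj.left_triangle_components, Functor.map_id, Category.comp_id]
  · ext Y
    let a : K.obj (R.obj (L.obj (R.obj Y))) ⟶ E.right.obj (L.obj (R.obj Y)) :=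
      m.right.app (L.obj (R.obj Y))
    let b : K.obj (R.obj Y) ⟶ E.right.obj Y := m.right.app Y
    have h : (𝟙 _ ≫ K.map (adj.unit.app (R.obj Y)) ≫ 𝟙 _) ≫ a = E.hom.app (R.obj Y) :=
      NatTrans.congr_app (StructuredArrow.w m) (R.obj Y)
    have h' : K.map (R.map (adj.counit.app Y)) ≫ b = a ≫ E.right.map (adj.counit.app Y) :=
      m.right.naturality (adj.counit.app Y)
    rw [Category.id_comp, Category.comp_id] at h
    change b = E.hom.app (R.obj Y) ≫ E.right.map (adj.counit.app Y)
    refine Eq.trans ?_ (congrArg (· ≫ E.right.map (adj.counit.app Y)) h)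
    rw [Category.assoc, ← h', ← Functor.map_comp_assoc, adj.right_triangle_components]
    exact ((congrArg (· ≫ b) (K.map_id _)).trans (Category.id_comp b)).symm

end Adjunction

variable {A : Type u} [Category.{v} A] [Abelian A] [HasDerivedCategory.{w} A]

/-- A K-injective model of `Y` is terminal among objects of K(A) over `Y`, because maps into it lift
uniquely from D(A). -/
lemma isLeftAdjoint_Qh (h : hasKInjectiveResolution A = ⊤) :
    (DerivedCategory.Qh (C := A)).IsLeftAdjoint := by
  have (Y : DerivedCategory A) :
      HasTerminal (CostructuredArrow (DerivedCategory.Qh (C := A)) Y) := ?_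
  · exact isLeftAdjoint_of_costructuredArrowTerminals _
  obtain ⟨E, ⟨e⟩⟩ : hasKInjectiveResolution A Y := by rw [h]; trivial
  choose l hl using fun (Z : CostructuredArrow (DerivedCategory.Qh (C := A)) Y) =>
    (E.property.map_bijective_of_isTriangulated DerivedCategory.Qh Z.left).2 (Z.hom ≫ e.inv)
  refine IsTerminal.hasTerminal (X := CostructuredArrow.mk (Y := E.obj) e.hom)
    (IsTerminal.ofUniqueHom (fun Z => CostructuredArrow.homMk (l Z) ?_) fun Z m => ?_)
  · dsimp
    rw [hl]
    simp
  · ext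
    refine (E.property.map_bijective_of_isTriangulated DerivedCategory.Qh Z.left).1 ?_
    have := CostructuredArrow.w m
    dsimp at this ⊢
    refine Eq.trans ?_ (hl Z).symm
    rw [← this]
    simp

lemma hasTotalRightDerivedFunctor (h : hasKInjectiveResolution A = ⊤)
    {B : Type u'} [Category.{v'} B] [Abelian B] [HasDerivedCategory.{w'} B]
    (F : A ⥤ B) [F.Additive] : HasTotalRightDerivedFunctor F := by
  have := isLeftAdjoint_Qh h
  let adj := Adjunction.ofIsLeftAdjoint (DerivedCategory.Qh (C := A))
  let := adj.rightAdjointCommShift ℤ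
  have := adj.commShift_of_leftAdjoint ℤ
  have := adj.isTriangulated_rightAdjoint
  refine ⟨_, inferInstance, adj.unitWhiskerRight
    (F.mapHomotopyCategory (ComplexShape.up ℤ) ⋙ DerivedCategory.Qh), inferInstance, ?_,
    ⟨adj.isLeftKanExtension_unitWhiskerRight _⟩⟩
  dsimp only [Adjunction.unitWhiskerRight]
  have : NatTrans.CommShift (Functor.leftUnitor
    (F.mapHomotopyCategory (ComplexShape.up ℤ) ⋙ DerivedCategory.Qh)).inv ℤ :=
    NatTrans.CommShift.of_iso_inv _ _
  infer_instance

end CategoryTheory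

end

/-! ### Building the derived category from the cogenerator -/

noncomputable section

namespace CategoryTheory

/-- The sequence `0 ⟶ Y ⟶ ∏ X n ⟶ ∏ X n ⟶ 0` given by `1 - shift` is exact if `X` is an eventually
constant tower of split epimorphisms with limit `Y`. -/
lemma shortExact_of_eventually_isIso {A : Type u} [Category.{v} A] [Abelian A] {X : ℕ → A}
    {c : Fan X} (hc : IsLimit c) (t : ∀ n, X (n + 1) ⟶ X n) [∀ n, IsSplitEpi (t n)]
    (D : c.pt ⟶ c.pt) (hD : ∀ n, D ≫ c.proj n = c.proj n - c.proj (n + 1) ≫ t n)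
    {Y : A} (p : Y ⟶ c.pt) (hp : p ≫ D = 0) (N : ℕ) (hN : ∀ n, N ≤ n → IsIso (p ≫ c.proj n)) :
    (ShortComplex.mk p D hp).ShortExact := by
  have hcompat {W : A} (f : W ⟶ c.pt) (hf : f ≫ D = 0) (n : ℕ) :
      f ≫ c.proj n = f ≫ c.proj (n + 1) ≫ t n := by
    rw [← sub_eq_zero, ← Preadditive.comp_sub, ← hD, reassoc_of% hf, zero_comp]
  have := hN N le_rfl
  have : Mono p := mono_of_mono p (c.proj N)
  have : Epi D := have := isSplitEpi_of_isLimit hc t D hD; inferInstance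
  -- From `N` on the transition maps are invertible, so a compatible family is determined by its
  -- component at `N`: upwards by cancelling `t`, downwards by compatibility.
  have hmono (n : ℕ) (hn : N ≤ n) : Mono (t n) := by
    have h₀ := hN n hn
    have h₁ := hN (n + 1) (by lia)
    have : t n = inv (p ≫ c.proj (n + 1)) ≫ p ≫ c.proj n := by
      rw [IsIso.eq_inv_comp, Category.assoc, ← hcompat p hp]
    rw [this]
    infer_instance
  refine ShortComplex.ShortExact.mk (ShortComplex.exact_of_f_is_kernel _
    (KernelFork.IsLimit.ofι' p hp fun {W} f hf =>
      ⟨(f ≫ c.proj N) ≫ inv (p ≫ c.proj N), Fan.IsLimit.hom_ext hc _ _ fun n => ?_⟩))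
  set g := (f ≫ c.proj N) ≫ inv (p ≫ c.proj N) with hg
  have hgp : (g ≫ p) ≫ D = 0 := by rw [Category.assoc, hp, comp_zero]
  have up (k : ℕ) : (g ≫ p) ≫ c.proj (N + k) = f ≫ c.proj (N + k) := by
    induction k with
    | zero => simp [hg]
    | succ k ih =>
      have := hmono (N + k) (by lia)
      rw [← cancel_mono (t (N + k)), Category.assoc (g ≫ p), Category.assoc f]
      exact ((hcompat _ hgp _).symm.trans ih).trans (hcompat _ hf _)
  have down (k : ℕ) : ∀ n, (g ≫ p) ≫ c.proj (n + k) = f ≫ c.proj (n + k) →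
      (g ≫ p) ≫ c.proj n = f ≫ c.proj n := by
    induction k with
    | zero => exact fun n h => h
    | succ k ih =>
      intro n h
      refine ih n ?_
      rw [hcompat _ hgp, hcompat _ hf, ← Category.assoc, ← Category.assoc]
      exact congrArg (· ≫ t (n + k)) h
  exact down N n (by rw [add_comm n N]; exact up n)

end CategoryTheory

namespace CochainComplex

variable {A : Type u} [Category.{v} A] [Abelian A]

/-- The brutal truncation of a complex above a given degree. -/
lemma exists_brutal_truncation (I : CochainComplex A ℤ) (n : ℤ) :
    ∃ (S : CochainComplex A ℤ) (p : I ⟶ S), S.IsStrictlyLE n ∧ Epi p ∧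
      ∀ i ≤ n, IsIso (p.f i) := by
  let e := ComplexShape.embeddingUpIntLE n
  have he : e.HasLift (𝟙 (I.restriction e)) := fun j hj => by
    refine (hj.2 (j + 1) ?_).elim
    change n - ((j + 1 : ℕ) : ℤ) + 1 = n - (j : ℤ)
    push_cast
    ring
  let p := e.liftExtend _ he
  have hS : CochainComplex.IsStrictlyLE ((I.restriction e).extend e) n := inferInstanceAs
    (HomologicalComplex.IsStrictlySupported ((I.restriction e).extend e) e)
  have hp (i : ℤ) (hi : i ≤ n) : IsIso (p.f i) := by
    have hi' : e.f (n - i).natAbs = i := by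
      change n - ((n - i).natAbs : ℤ) = i
      lia
    rw [e.isIso_liftExtend_f_iff _ _ hi']
    exact inferInstanceAs (IsIso (𝟙 _))
  refine ⟨_, p, hS, HomologicalComplex.epi_of_epi_f _ fun i => ?_, hp⟩
  by_cases hi : i ≤ n
  · have := hp i hi
    infer_instance
  · exact (isZero_of_isStrictlyLE _ n i (by lia)).epi _

/-- A bounded below complex is the limit of its brutal truncations, with an exact sequence
`0 ⟶ I ⟶ ∏ S n ⟶ ∏ S n ⟶ 0`. -/
lemma exists_shortExact_brutal_truncations [HasCountableProducts A] (I : CochainComplex A ℤ)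
    (d : ℤ) : ∃ (S : ℕ → CochainComplex A ℤ) (p : ∀ n, I ⟶ S n)
      (f : I ⟶ ∏ᶜ S) (g : ∏ᶜ S ⟶ ∏ᶜ S) (hfg : f ≫ g = 0),
      (∀ n, (S n).IsStrictlyLE (d + n) ∧ ∀ i ≤ d + n, IsIso ((p n).f i)) ∧
      (ShortComplex.mk f g hfg).ShortExact := by
  choose S p hS hp hpi using fun n : ℕ => I.exists_brutal_truncation (d + n)
  have ht (n : ℕ) : ∃ t : S (n + 1) ⟶ S n, p (n + 1) ≫ t = p n := by
    refine ⟨Abelian.epiDesc (p (n + 1)) (p n) ?_, Abelian.comp_epiDesc _ _ _⟩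
    ext i
    rw [HomologicalComplex.comp_f, HomologicalComplex.zero_f]
    by_cases hi : i ≤ d + n
    · have := hpi (n + 1) i (by push_cast; lia)
      have h0 : (kernel.ι (p (n + 1))).f i = 0 := by
        rw [← cancel_mono ((p (n + 1)).f i), ← HomologicalComplex.comp_f, kernel.condition]
        simp
      rw [h0, zero_comp]
    · have := hS n
      exact (isZero_of_isStrictlyLE _ (d + n) i (by lia)).eq_of_tgt _ _
  choose t ht using ht
  have hfg : Pi.lift p ≫ oneSubShift S t = 0 :=
    (comp_oneSubShift_eq_zero_iff t _).2 fun n => by simp [ht]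
  refine ⟨S, p, Pi.lift p, oneSubShift S t, hfg, fun n => ⟨hS n, hpi n⟩, ?_⟩
  rw [HomologicalComplex.shortExact_iff_degreewise_shortExact]
  intro i
  have hc : IsLimit (Fan.mk ((∏ᶜ S).X i) fun n => (Pi.π S n).f i) :=
    isLimitMapConeFanMkEquiv (HomologicalComplex.eval A (ComplexShape.up ℤ) i) S _
      (isLimitOfPreserves (HomologicalComplex.eval A (ComplexShape.up ℤ) i) (productIsProduct S))
  have (n : ℕ) : IsSplitEpi ((t n).f i) := by
    by_cases hi : i ≤ d + n
    · have h₁ := hpi (n + 1) i (by push_cast; lia)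
      have h₂ := hpi n i hi
      have : (t n).f i = inv ((p (n + 1)).f i) ≫ (p n).f i := by
        rw [IsIso.eq_inv_comp, ← HomologicalComplex.comp_f, ht]
      rw [this]
      infer_instance
    · have := hS n
      exact ⟨⟨0, (isZero_of_isStrictlyLE _ (d + n) i (by lia)).eq_of_tgt _ _⟩⟩
  refine shortExact_of_eventually_isIso hc (fun n => (t n).f i) _ (fun n => ?_) _ _
    -- In degree `i` the tower is constant as soon as `d + n ≥ i`.
    (i - d).toNat fun n hn => ?_
  · exact HomologicalComplex.congr_hom (oneSubShift_π S t n) i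
  · change IsIso ((Pi.lift p).f i ≫ (Pi.π S n).f i)
    rw [← HomologicalComplex.comp_f, Pi.lift_π]
    exact hpi n i (by lia)

end CochainComplex

namespace CategoryTheory

variable {A : Type u} [Category.{v} A] [Abelian A] [HasDerivedCategory.{w} A]

variable (A) in
/-- The objects of the derived category that are isomorphic to complexes of injective objects
concentrated in a single degree. -/
def injectiveStalk : ObjectProperty (DerivedCategory A) := fun X =>
  ∃ (I : CochainComplex A ℤ) (d : ℤ), I.IsStrictlyGE d ∧ I.IsStrictlyLE d ∧
    (∀ i, Injective (I.X i)) ∧ Nonempty (X ≅ DerivedCategory.Q.obj I)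

instance : (injectiveStalk A).IsStableUnderShift ℤ where
  isStableUnderShiftBy n := ⟨by
    rintro X ⟨I, d, _, _, hI, ⟨e⟩⟩
    exact ⟨I⟦n⟧, d - n, I.isStrictlyGE_shift d n _ (by lia), I.isStrictlyLE_shift d n _ (by lia),
      fun i => hI (i + n),
      ⟨(shiftFunctor _ n).mapIso e ≪≫ ((DerivedCategory.Q.commShiftIso n).app I).symm⟩⟩⟩

variable (A) in
/-- The objects of the derived category that are iterated extensions of stalk complexes of
injective objects. -/
def boundedInjective : ObjectProperty (DerivedCategory A) := fun X =>
  ∃ n, (injectiveStalk A).extensionProductIter n X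

instance : (boundedInjective A).IsStableUnderShift ℤ where
  isStableUnderShiftBy n := ⟨by
    rintro X ⟨k, hX⟩
    exact ⟨k, ObjectProperty.le_shift ((injectiveStalk A).extensionProductIter k) n _ hX⟩⟩

/-- Induction on the length: the kernel of the brutal truncation is the stalk in the top degree.
Degrees `d` to `d + n` give `n + 1` stalks, hence `n` extensions. -/
lemma extensionProductIter_injectiveStalk (d : ℤ) (n : ℕ) (I : CochainComplex A ℤ)
    (h₁ : I.IsStrictlyGE d) (h₂ : I.IsStrictlyLE (d + n)) (hI : ∀ i, Injective (I.X i)) :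
    (injectiveStalk A).extensionProductIter n (DerivedCategory.Q.obj I) := by
  induction n generalizing I with
  | zero => exact ⟨I, d, h₁, by simpa using h₂, hI, ⟨Iso.refl _⟩⟩
  | succ n ih =>
    obtain ⟨S, p, hS, hp, hpi⟩ := I.exists_brutal_truncation (d + n)
    have hS₁ : S.IsStrictlyGE d := by
      rw [CochainComplex.isStrictlyGE_iff]
      intro i hi
      have := hpi i (by lia)
      exact (I.isZero_of_isStrictlyGE d i).of_iso (asIso (p.f i)).symm
    have hSI (i : ℤ) : Injective (S.X i) := by
      by_cases hi : i ≤ d + n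
      · have := hpi i hi
        exact Injective.of_iso (asIso (p.f i)) (hI i)
      · exact (S.isZero_of_isStrictlyLE (d + n) i (by lia)).injective
    have hses : (ShortComplex.mk (kernel.ι p) p (kernel.condition p)).ShortExact :=
      { exact := ShortComplex.exact_kernel p }
    have hz (i : ℤ) (hi : i ≠ d + n + 1) : IsZero ((kernel p).X i) := by
      rw [IsZero.iff_id_eq_zero, ← cancel_mono ((kernel.ι p).f i), zero_comp, Category.id_comp]
      obtain hi | hi : i ≤ d + n ∨ d + (n + 1 : ℕ) < i := by push_cast; lia
      · have := hpi i hi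
        rw [← cancel_mono (p.f i), ← HomologicalComplex.comp_f, kernel.condition]
        simp
      · exact (I.isZero_of_isStrictlyLE (d + (n + 1 : ℕ)) i hi).eq_of_tgt _ _
    rw [ObjectProperty.extensionProductIter_succ]
    refine ⟨_, _, _, _, _, DerivedCategory.triangleOfSES_distinguished hses,
      ⟨kernel p, d + n + 1, ?_, ?_, fun i => ?_, ⟨Iso.refl _⟩⟩, ih S hS₁ hS hSI⟩
    · rw [CochainComplex.isStrictlyGE_iff]
      exact fun i hi => hz i (by lia)
    · rw [CochainComplex.isStrictlyLE_iff]
      exact fun i hi => hz i (by lia)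
    · by_cases hi : i = d + n + 1
      · have hex := (HomologicalComplex.shortExact_iff_degreewise_shortExact _).1 hses i
        have hSi := S.isZero_of_isStrictlyLE (d + n) i (by lia)
        have := hex.mono_f
        have : Epi ((kernel.ι p).f i) := hex.exact.epi_f (hSi.eq_of_tgt _ _)
        have : IsIso ((kernel.ι p).f i) := isIso_of_mono_of_epi _
        exact Injective.of_iso (asIso ((kernel.ι p).f i)).symm (hI i)
      · exact (hz i hi).injective

/-- The exact sequence of brutal truncations becomes a triangle in D(A), and its product of
complexes is also a product there because the truncations are K-injective. -/
lemma boundedBelowInjective_le_extensionProduct [HasCountableProducts A] :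
    boundedBelowInjective A ≤ (ObjectProperty.smallProducts.{v} (boundedInjective A)).extensionProduct
      (.smallProducts.{v} (boundedInjective A)) := by
  rintro X ⟨I, d, hd, hI, ⟨e⟩⟩
  obtain ⟨S, p, f, g, hfg, hS, hses⟩ := I.exists_shortExact_brutal_truncations d
  have hS₁ (n : ℕ) : (S n).IsStrictlyGE d := by
    rw [CochainComplex.isStrictlyGE_iff]
    intro i hi
    have := (hS n).2 i (by lia)
    exact (I.isZero_of_isStrictlyGE d i).of_iso (asIso ((p n).f i)).symm
  have hSI (n : ℕ) (i : ℤ) : Injective ((S n).X i) := by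
    by_cases hi : i ≤ d + n
    · have := (hS n).2 i hi
      exact Injective.of_iso (asIso ((p n).f i)) (hI i)
    · have := (hS n).1
      exact ((S n).isZero_of_isStrictlyLE (d + n) i (by lia)).injective
  obtain ⟨hc⟩ := CochainComplex.nonempty_isLimit_Q_of_isKInjective (productIsProduct S)
    fun n => CochainComplex.isKInjective_of_injective (S n) d
  have h : ObjectProperty.smallProducts.{v} (boundedInjective A) (DerivedCategory.Q.obj (∏ᶜ S)) :=
    ObjectProperty.smallProducts_of_nat hc fun n =>
      ⟨n, extensionProductIter_injectiveStalk d n (S n) (hS₁ n) (hS n).1 (hSI n)⟩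
  refine ObjectProperty.prop_of_iso _ e.symm ?_
  exact ⟨_, _, _, _, _, inv_rot_of_distTriang _ (DerivedCategory.triangleOfSES_distinguished hses),
    ObjectProperty.le_shift _ (-1) _ h, h⟩

/-- An injective object embeds in a power of `Q`, and the embedding splits. -/
lemma injectiveStalk_le_retractClosure [HasProducts.{v} A] (Q : A) [Injective Q]
    (hQ : IsCoseparator Q) :
    injectiveStalk A ≤ (ObjectProperty.smallProducts.{v} (ObjectProperty.ofObj
      fun k : ULift.{v} ℤ => (DerivedCategory.singleFunctor A k.down).obj Q)).retractClosure := by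
  rintro X ⟨I, d, _, _, hI, ⟨e⟩⟩
  obtain ⟨M, ⟨e'⟩⟩ := I.exists_iso_single d
  have : Injective M := Injective.of_iso
    ((HomologicalComplex.eval A (ComplexShape.up ℤ) d).mapIso e' ≪≫ HomologicalComplex.singleObjXSelf (ComplexShape.up ℤ) d M) (hI d)
  have := hQ.mono_pi_lift M
  let r : Retract M (∏ᶜ fun _ : M ⟶ Q => Q) :=
    { i := Pi.lift fun f => f
      r := Injective.factorThru (𝟙 M) (Pi.lift fun f => f)
      retract := Injective.comp_factorThru _ _ }
  let s := HomologicalComplex.single A (ComplexShape.up ℤ) d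
  have hc : IsLimit (Fan.mk (s.obj (∏ᶜ fun _ : M ⟶ Q => Q)) fun f => s.map (Pi.π _ f)) :=
    isLimitMapConeFanMkEquiv s _ _ (isLimitOfPreserves s (productIsProduct _))
  have : CochainComplex.IsKInjective (s.obj Q) := by
    have (i : ℤ) : Injective ((s.obj Q).X i) := by
      by_cases hi : i = d
      · subst hi
        exact Injective.of_iso (HomologicalComplex.singleObjXSelf (ComplexShape.up ℤ) i Q).symm inferInstance
      · exact (HomologicalComplex.isZero_single_obj_X _ _ _ _ hi).injective
    exact CochainComplex.isKInjective_of_injective (s.obj Q) d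
  obtain ⟨hc'⟩ := CochainComplex.nonempty_isLimit_Q_of_isKInjective hc fun _ => this
  refine ⟨DerivedCategory.Q.obj (s.obj (∏ᶜ fun _ : M ⟶ Q => Q)), ⟨_, _, _, ⟨hc'⟩, fun f => ?_⟩,
    ⟨(Retract.ofIso (e ≪≫ DerivedCategory.Q.mapIso e')).trans
      ((r.map s).map DerivedCategory.Q)⟩⟩
  exact ⟨(⟨d⟩ : ULift.{v} ℤ)⟩

lemma oppositeSatisfiesBrownRepresentability [HasProducts.{v} A] (Q : A) [Injective Q]
    (hQ : IsCoseparator Q) [LocallySmall.{v} (DerivedCategory A)]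
    (hA : IsLeftCompleteDerivedCategory A) :
    OppositeSatisfiesBrownRepresentability.{v} (DerivedCategory A) := by
  intro F _ _
  have := hA.choose
  have : HasProducts.{0} (DerivedCategory A) := has_smallest_products_of_hasProducts.{v}
  have := isIdempotentComplete_of_hasProducts (DerivedCategory A)
  have : HasCountableProducts A := inferInstance
  have := enoughInjectives_of_isCoseparator Q hQ
  have h₀ : F.IsSolvableOn (injectiveStalk A) :=
    (F.isSolvableOn_ofObj _).smallProducts.retractClosure.anti
      (injectiveStalk_le_retractClosure Q hQ)
  have h₁ : F.IsSolvableOn (boundedInjective A) :=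
    Functor.isSolvableOn_exists (J := ULift.{v} ℕ)
      (P := fun n => (injectiveStalk A).extensionProductIter n.down)
      (fun n => h₀.extensionProductIter n.down) |>.anti fun X ⟨n, hX⟩ => ⟨⟨n⟩, hX⟩
  have h₂ : F.IsSolvableOn (boundedBelowInjective A) :=
    (h₁.smallProducts.extensionProduct h₁.smallProducts).anti
      boundedBelowInjective_le_extensionProduct
  exact ((h₂.smallProducts.extensionProduct h₂.smallProducts).anti fun X _ =>
    extensionProduct_smallProducts_boundedBelowInjective hA X).exists_equiv

end CategoryTheory

end

theorem theorem1 (A : Type u) [Category.{v} A] [Abelian A] [HasDerivedCategory.{w} A]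
    [HasLimits A] (hQ : ∃ Q : A, Injective Q ∧ IsCoseparator Q)
    (hA : IsLeftCompleteDerivedCategory A) :
    (∀ X : HomotopyCategory A (ComplexShape.up ℤ),
      ∃ (E : HomotopyCategory A (ComplexShape.up ℤ)) (f : X ⟶ E),
        homotopicallyInjective A E ∧ HomotopyCategory.quasiIso A (ComplexShape.up ℤ) f) ∧
    (((homotopicallyInjective A).ι ⋙ DerivedCategory.Qh).IsEquivalence ∧
      LocallySmall.{v} (DerivedCategory A)) ∧
    (∀ (B : Type u') [Category.{v'} B] [Abelian B] [HasDerivedCategory.{w'} B]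
      (F : A ⥤ B) [F.Additive] [PreservesFiniteLimits F], HasTotalRightDerivedFunctor F) ∧
    OppositeSatisfiesBrownRepresentability.{v} (DerivedCategory A) := by
  obtain ⟨Q, _, hQ⟩ := hQ
  have := enoughInjectives_of_isCoseparator Q hQ
  have h := hasKInjectiveResolution_of_isLeftComplete hA
  have h' : hasKInjectiveResolution A = ⊤ := by
    ext X
    exact iff_of_true (h X) trivial
  have := locallySmall_derivedCategory h'
  have : ((homotopicallyInjective A).ι ⋙ DerivedCategory.Qh).EssSurj := ⟨h⟩
  exact ⟨fun X => exists_quasiIso_homotopicallyInjective X (h _), ⟨{ }, inferInstance⟩,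
    fun B _ _ _ F _ _ => hasTotalRightDerivedFunctor h' F,
    oppositeSatisfiesBrownRepresentability Q hQ hA⟩
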